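/- **Setting.** Let $C,A_1,\dots,A_M$ be Hermitian operators on $n$ qubits ($M\ge 1$, $A_M=I$), $b\in\mathbb R^M$, $\lambda:=b_M$, and consider the SDP $\sup\{\operatorname{Tr}[CX]: X\succeq 0,\ \operatorname{Tr}[A_iX]=b_i,\ i=1,\dots,M\}$. Let $U(\theta)=U_r(\theta_r)\cdots U_1(\theta_1)$, $U_j(\theta_j)=e^{-i\theta_jH_j}W_j$, with $H_j$ Hermitian and $W_j$ unitary, be a parameterized circuit on two $n$-qubit registers $RS$, and put $\langle I\otimes O\rangle_\theta=\langle 0|U(\theta)^\dagger(I_R\otimes O_S)U(\theta)|0\rangle$, $f(\theta)=\lambda\langle I\otimes C\rangle_\theta$, $\Phi(\theta)=(\langle I\otimes A_i\rangle_\theta)_{i=1}^M$, $A(\theta)=\lambda\Phi(\theta)-b$ with Jacobian $J_A$, and $$\mathcal L_c(\theta,y)=f(\theta)+y^\top(b-\lambda\Phi(\theta))+\tfrac c2\|b-\lambda\Phi(\theta)\|^2 .$$ A point $\theta\in[0,2\pi]^r$ is a first order $(\epsilon,c)$-stationary point if there is $y\in\mathbb R^M$ with $\|\nabla_\theta\mathcal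 L_c(\theta,y)\|\le\epsilon$ and $\|A(\theta)\|\le\epsilon$. **Algorithm iVQAEC.** Let $\mu>1$, $\eta^1>0$, $c_k=\mu^k$, $y^1=y^0=0$, and let $\theta^1$ be given. For $k=1,2,\dots$: an inexact solver finds $\theta^{k+1}$ with $\|\nabla_\theta\mathcal L_{c_k}(\theta^{k+1},y^k)\|\le 1/c_k$; then $$\eta^{k+1}=\eta^1\min\Big\{\frac{\|A(\theta^1)\|\ln^2 2}{\|A(\theta^{k+1})\|(k+1)\ln^2(k+2)},1\Big\},\qquad y^{k+1}=y^k+\eta^{k+1}A(\theta^{k+1})$$ (the minimum is $1$ if $A(\theta^{k+1})=0$). With precision $\epsilon$, the algorithm stops as soon as $\|\nabla_\theta\mathcal L_{c_k}(\theta^{k+1},y^{k+1})\|+\|A(\theta^{k+1})\|\le\epsilon$. **Assumptions.** Let $k_1\ge k_0\ge 2$ and $\theta^k\in[0,2\pi]^r$ for $k_0\le k\le k_1$, where $\theta^1,\dots,\theta^{k_1}$ are produced by iVQAEC. Suppose that $f$ and $A$ are Lipschitz on $[0,2\pi]^r$ with constants $L_f$, $L_A$; that $\nabla_\theta\mathcal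 L_c(\cdot,y)$ is $L_{c,y}$-Lipschitz on $\mathbb R^r$ for all $c>0$, $y\in\mathbb R^M$; that for some $\nu>0$, $\nu\|A(\theta^k)\|\le\|-J_A(\theta^k)^\top A(\theta^k)\|$ for $k_0\le k\le k_1$; and that $k_0$ is so large that $1/c_{k_0-1}\le L_f$. Put $y_{\max}=\|y^0\|+\eta^1\|A(\theta^1)\|\ln^2 2$. **Convergence rate.** For every $k_0\le k\le k_1$, $\theta^k$ is a first order $(\epsilon_k,c_k)$-stationary point with $$\epsilon_k=\frac1{c_{k-1}}\Big(\frac{2(L_f+y_{\max}L_A)(1+\eta^kL_A)}{\nu}+1\Big)\le\frac{Q}{c_{k-1}},\qquad Q:=\frac{2(L_f+y_{\max}L_A)(1+\eta^1L_A)}{\nu}+1 .$$ **Total complexity with APGM.** Let the solver be the monotone accelerated proximal gradient method for nonconvex problems, applied to the maximization of $\mathcal L_{c_k}(\cdot,y^k)$ (nonsmooth term $0$): with $F=\mathcal L_{c_k}(\cdot,y^k)$, $x_0=x_1=z_1$, $t_0=0$, $t_1=1$, iterate $w_j=x_j+\frac{t_{j-1}}{t_j}(z_j-x_j)+\frac{t_{j-1}-1}{t_j}(x_j-x_{j-1})$,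 $z_{j+1}=w_j+\alpha_y\nabla F(w_j)$, $v_{j+1}=x_j+\alpha_x\nabla F(x_j)$, $t_{j+1}=\frac12(\sqrt{4t_j^2+1}+1)$, $x_{j+1}=z_{j+1}$ if $F(z_{j+1})\ge F(v_{j+1})$ and $x_{j+1}=v_{j+1}$ otherwise, with $\alpha_x=\tau_x/L_{c_k,y^k}$, $\alpha_y=\tau_y/L_{c_k,y^k}$, $\tau_x,\tau_y\in(0,1)$ fixed (a step size is $0$ if $L_{c_k,y^k}=0$). It always reaches the required tolerance after finitely many iterations, from any starting point and for any $c>0$, $y$ and positive tolerance. Suppose moreover that $r\ge1$, that $\theta^1,\dots,\theta^{k_1}$ lie in $[0,2\pi]^r$, that the $k$-th call starts at an arbitrary point of $[0,2\pi]^r$ and returns its first iterate $\theta^{k+1}$ that meets the tolerance, after $N_k$ iterations, and that $L_{c,y}\le\Gamma(1+\|y\|+c)$ for all $c>0,y$ and $y_{\max}\le Y$. Let $0<\epsilon\le1/\mu$, and let the run be long enough, in the sense that the stopping test with precision $\epsilon$ holds at $\theta^{k_1}$ or $Q/c_{k_1-1}\le\epsilon$. Then the stopping test with precision $\epsilon$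 holds for the first time at some $\theta^k$, $2\le k\le k_1$; this $\theta^k$ is a first order $(\epsilon,c_k)$-stationary point; and the total cost $T=\sum_{j=1}^{k-1}(N_j+1)$, which bounds both the number of passes through the loop and the number of solver iterations, satisfies $$T\le K\,\frac{rQ^3}{\epsilon^3}\log_\mu\!\Big(\frac Q\epsilon\Big),\qquad\text{i.e. } T=\mathcal O\Big(\frac{rQ^3}{\epsilon^3}\log_\mu\frac Q\epsilon\Big)=\tilde{\mathcal O}\Big(\frac{rQ^3}{\epsilon^3}\Big),$$ where $K$ depends only on $\mu,\eta^1,\nu,L_f,L_A,\tau_x,\tau_y,k_0,\Gamma,Y$ (not on $\epsilon$, $r$, $n$, $M$, the operators, the circuit or the run). -/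

import Mathlib

open scoped NNReal Kronecker

noncomputable section

namespace VQA

/-! ### Parameterized quantum circuits -/

/-- Labels of the computational basis of `n` qubits. -/
abbrev Qubits (n : ℕ) : Type := Fin n → Fin 2

/-- A variational ansatz with `r` parameters on two registers `R`, `S` of `n` qubits each: the
`j`-th layer is `exp (-i θ_j H_j) W_j` with `H_j` Hermitian and `W_j` unitary. -/
structure Ansatz (n r : ℕ) where
  H : Fin r → Matrix (Qubits n × Qubits n) (Qubits n × Qubits n) ℂ
  W : Fin r → Matrix (Qubits n × Qubits n) (Qubits n × Qubits n) ℂ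
  H_hermitian : ∀ j, (H j).IsHermitian
  W_unitary : ∀ j, W j ∈ Matrix.unitaryGroup (Qubits n × Qubits n) ℂ

/-- The parameter space `ℝ^r` with its Euclidean norm. -/
abbrev Param (r : ℕ) : Type := EuclideanSpace ℝ (Fin r)

/-- The box `[0, 2π]^r`. -/
def box (r : ℕ) : Set (Param r) := {θ | ∀ i, θ i ∈ Set.Icc 0 (2 * Real.pi)}

/-- The layer `U_j(θ_j) = exp (-i θ_j H_j) W_j`. -/
def Ansatz.layer {n r : ℕ} (U : Ansatz n r) (θ : Param r) (j : Fin r) :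
    Matrix (Qubits n × Qubits n) (Qubits n × Qubits n) ℂ :=
  NormedSpace.exp ((-(Complex.I * (θ j : ℂ))) • U.H j) * U.W j

/-- The unitary `U(θ) = U_r(θ_r) ⋯ U_1(θ_1)`. -/
def Ansatz.unitary {n r : ℕ} (U : Ansatz n r) (θ : Param r) :
    Matrix (Qubits n × Qubits n) (Qubits n × Qubits n) ℂ :=
  (List.ofFn (U.layer θ)).reverse.prod

/-- The state `U(θ)|0⟩`, where `|0⟩` is the all-zeros basis vector of `RS`. -/
def Ansatz.state {n r : ℕ} (U : Ansatz n r) (θ : Param r) : Qubits n × Qubits n → ℂ :=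
  (U.unitary θ).mulVec (Pi.single (0, 0) 1)

/-- The expectation value `⟨I_R ⊗ O_S⟩_θ` (a real number when `O` is Hermitian). -/
def Ansatz.expect {n r : ℕ} (U : Ansatz n r) (O : Matrix (Qubits n) (Qubits n) ℂ)
    (θ : Param r) : ℝ :=
  (star (U.state θ) ⬝ᵥ
    ((1 : Matrix (Qubits n) (Qubits n) ℂ) ⊗ₖ O).mulVec (U.state θ)).re

/-! ### Equality constrained standard-form SDPs and the augmented Lagrangian -/

/-- Data of `sup {Tr[C X] : X ≥ 0, Tr[A_i X] = b_i, i = 1, …, M}` with `M = m + 1` constraints on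
`n` qubits, the last of which is the trace constraint, i.e. `A_M = I`. -/
structure SDP (n m : ℕ) where
  C : Matrix (Qubits n) (Qubits n) ℂ
  A : Fin (m + 1) → Matrix (Qubits n) (Qubits n) ℂ
  b : EuclideanSpace ℝ (Fin (m + 1))
  C_hermitian : C.IsHermitian
  A_hermitian : ∀ i, (A i).IsHermitian
  A_last : A (Fin.last m) = 1

/-- The space `ℝ^M` of dual variables, `M = m + 1`. -/
abbrev Dual (m : ℕ) : Type := EuclideanSpace ℝ (Fin (m + 1))

variable {n m r : ℕ}

/-- The trace value `λ = b_M`. -/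
def SDP.lam (P : SDP n m) : ℝ := P.b (Fin.last m)

/-- The objective `f(θ) = λ ⟨I ⊗ C⟩_θ`. -/
def obj (P : SDP n m) (U : Ansatz n r) (θ : Param r) : ℝ := P.lam * U.expect P.C θ

/-- The constraint map `A(θ) = λ Φ(θ) - b`, `Φ(θ) = (⟨I ⊗ A_i⟩_θ)_i`. -/
def constr (P : SDP n m) (U : Ansatz n r) (θ : Param r) : Dual m :=
  P.lam • (WithLp.toLp 2 (fun i => U.expect (P.A i) θ) : Dual m) - P.b

/-- The augmented Lagrangian
`L_c(θ, y) = λ ⟨I ⊗ C⟩_θ + yᵀ (b - λ Φ(θ)) + (c / 2) ‖b - λ Φ(θ)‖²`. -/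
def augLag (P : SDP n m) (U : Ansatz n r) (c : ℝ) (y : Dual m) (θ : Param r) : ℝ :=
  obj P U θ + inner ℝ y (-constr P U θ) + c / 2 * ‖-constr P U θ‖ ^ 2

/-- `∇_θ L_c(θ, y)`. -/
def gradLag (P : SDP n m) (U : Ansatz n r) (c : ℝ) (y : Dual m) (θ : Param r) : Param r :=
  gradient (augLag P U c y) θ

/-- `J_A(θ)ᵀ A(θ)`, where `J_A` is the Jacobian of the constraint map. -/
def jacTConstr (P : SDP n m) (U : Ansatz n r) (θ : Param r) : Param r :=
  ContinuousLinearMap.adjoint (fderiv ℝ (constr P U) θ) (constr P U θ)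

/-- `θ` is a first order `(ε, c)`-stationary point of `sup_θ inf_y L_c(θ, y)`. -/
def IsStationary (P : SDP n m) (U : Ansatz n r) (ε c : ℝ) (θ : Param r) : Prop :=
  θ ∈ box r ∧ ∃ y : Dual m, ‖gradLag P U c y θ‖ ≤ ε ∧ ‖constr P U θ‖ ≤ ε

/-! ### The algorithm iVQAEC -/

open Classical in
/-- `θ^1, …, θ^{k₁}`, `y^0, …, y^{k₁}`, `η^1, …, η^{k₁}` are produced by the loop of iVQAEC with
`c_k = μ^k` and tolerance `1 / c_k`, `k = 1, …, k₁ - 1`. The first dual variable used is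
`y^1 = y^0 = 0`. In the rule for `η` the minimum is `1` when `A(θ^{k+1}) = 0`. -/
structure IsRun (P : SDP n m) (U : Ansatz n r) (μ η₁ : ℝ) (k₁ : ℕ)
    (θ : ℕ → Param r) (y : ℕ → Dual m) (η : ℕ → ℝ) : Prop where
  y_zero : y 0 = 0
  y_one : y 1 = y 0
  eta_one : η 1 = η₁
  inexact : ∀ k, 1 ≤ k → k < k₁ → ‖gradLag P U (μ ^ k) (y k) (θ (k + 1))‖ ≤ 1 / μ ^ k
  eta_step : ∀ k, 1 ≤ k → k < k₁ → η (k + 1) = η₁ *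
    (if constr P U (θ (k + 1)) = 0 then 1 else
      min (‖constr P U (θ 1)‖ * Real.log 2 ^ 2 /
        (‖constr P U (θ (k + 1))‖ * ((k : ℝ) + 1) * Real.log ((k : ℝ) + 2) ^ 2)) 1)
  dual_step : ∀ k, 1 ≤ k → k < k₁ → y (k + 1) = y k + η (k + 1) • constr P U (θ (k + 1))

/-- The stopping test of iVQAEC with precision `ε`, applied when `θ^k` and `y^k` (`k ≥ 2`) have
just been computed; the penalty parameter is then `c_{k-1}`. -/
def StopTest (P : SDP n m) (U : Ansatz n r) (μ ε : ℝ)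
    (θ : ℕ → Param r) (y : ℕ → Dual m) (k : ℕ) : Prop :=
  ‖gradLag P U (μ ^ (k - 1)) (y k) (θ k)‖ + ‖constr P U (θ k)‖ ≤ ε

/-- `y_max = ‖y^0‖ + η^1 ‖A(θ^1)‖ ln² 2`. -/
def yMax (P : SDP n m) (U : Ansatz n r) (η₁ : ℝ) (θ : ℕ → Param r) (y : ℕ → Dual m) : ℝ :=
  ‖y 0‖ + η₁ * ‖constr P U (θ 1)‖ * Real.log 2 ^ 2

/-- `2 (L_f + y_max L_A) (1 + η L_A) / ν + 1`. -/
def constQ (Lf LA ymax ν η : ℝ) : ℝ := 2 * (Lf + ymax * LA) * (1 + η * LA) / ν + 1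

/-! ### The monotone accelerated proximal gradient method for nonconvex problems -/

/-- State of the method: `x_{j-1}`, `x_j`, `z_j`, `t_{j-1}`, `t_j`. -/
structure APGState (r : ℕ) where
  xPrev : Param r
  x : Param r
  z : Param r
  tPrev : ℝ
  t : ℝ

/-- The extrapolated point
`w_j = x_j + (t_{j-1} / t_j) (z_j - x_j) + ((t_{j-1} - 1) / t_j) (x_j - x_{j-1})`. -/
def APGState.extrap (s : APGState r) : Param r :=
  s.x + (s.tPrev / s.t) • (s.z - s.x) + ((s.tPrev - 1) / s.t) • (s.x - s.xPrev)

/-- One iteration, for the maximization of `F`, with fixed step sizes `αx`, `αy`: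
`z_{j+1} = w_j + αy ∇F(w_j)`, `v_{j+1} = x_j + αx ∇F(x_j)`, `x_{j+1}` is the better of the two, and
`t_{j+1} = (√(4 t_j² + 1) + 1) / 2`. The nonsmooth term is `0`, so proximal maps are identities. -/
def apgStep (F : Param r → ℝ) (αx αy : ℝ) (s : APGState r) : APGState r :=
  let z' := s.extrap + αy • gradient F s.extrap
  let v' := s.x + αx • gradient F s.x
  { xPrev := s.x
    x := if F v' ≤ F z' then z' else v'
    z := z'
    tPrev := s.t
    t := (Real.sqrt (4 * s.t ^ 2 + 1) + 1) / 2 }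

/-- The `j`-th iterate of the method started at `s`. -/
def apgIter (F : Param r → ℝ) (αx αy : ℝ) (s : Param r) (j : ℕ) : Param r :=
  ((apgStep F αx αy)^[j] { xPrev := s, x := s, z := s, tPrev := 0, t := 1 }).x

/-- The `j`-th iterate of the solver on the subproblem `max L_c(·, y)`, started at `s`, with step
sizes `τx / L` and `τy / L`, where `L` is a Lipschitz constant of `∇_θ L_c(·, y)`. -/
def solverIter (P : SDP n m) (U : Ansatz n r) (τx τy : ℝ) (L : ℝ → Dual m → ℝ≥0)
    (c : ℝ) (y : Dual m) (s : Param r) (j : ℕ) : Param r :=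
  apgIter (augLag P U c y) (τx / (L c y : ℝ)) (τy / (L c y : ℝ)) s j

/-- In the `k`-th pass through the loop (`1 ≤ k < k₁`), `θ^{k+1}` is the first iterate of the
solver, started at `s k ∈ [0, 2π]^r`, that meets the tolerance `1 / c_k`; it is reached after `N k`
iterations. -/
def UsesAPGM (P : SDP n m) (U : Ansatz n r) (μ τx τy : ℝ) (L : ℝ → Dual m → ℝ≥0) (k₁ : ℕ)
    (θ : ℕ → Param r) (y : ℕ → Dual m) (s : ℕ → Param r) (N : ℕ → ℕ) : Prop :=
  ∀ k, 1 ≤ k → k < k₁ →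
    s k ∈ box r ∧
    IsLeast {j | ‖gradLag P U (μ ^ k) (y k)
      (solverIter P U τx τy L (μ ^ k) (y k) (s k) j)‖ ≤ 1 / μ ^ k} (N k) ∧
    θ (k + 1) = solverIter P U τx τy L (μ ^ k) (y k) (s k) (N k)

end VQA

end

/-! Everything rests on the formula `∇_θ L_c(θ, y) = ∇f - J_Aᵀ (y - c A)` (`gradLag_eq`). The pair
`(c, y)` enters only through `y - c A(θ)`, so a change of `c` can be absorbed into `y`, and
stationarity for one penalty parameter gives stationarity for every other.

Convergence: solving the formula for `c J_Aᵀ A` bounds it by the tolerance plus `L_f + L_A ‖y‖`. The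
rule for `η` makes the dual increments summable, so `‖y‖ ≤ 2 y_max`. With the regularity constant
`ν` this yields `‖A‖ = O(1/c)`. The dual step then disturbs the gradient by at most `η L_A ‖A‖`,
which is of the same order.

Complexity: the monotone solver gains at least a multiple of `‖∇F‖² / L` per iteration, so a call
with tolerance `1/c` takes at most about `L c²` times the available gap. Here `L = O(c)`. The gap is
`O(r)`, because the box has diameter `2π √r` and the penalty term at the returned point is `O(r)`.
Hence `N_k = O(r c_k³)`. These bounds sum geometrically, and the run stops once `c` is of order
`Q/ε`. The logarithm is at least `1` and is not needed for the estimate. -/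

noncomputable section

namespace VQA

variable {n m r : ℕ}

/-! ### Smoothness of expectation values -/

section MatrixExp

attribute [local instance] Matrix.linftyOpNormedRing Matrix.linftyOpNormedAlgebra

/-- No norm on matrices appears in the statement; the local operator norm only serves to make the
exponential analytic. -/
theorem contDiff_matrix_exp_smul_entry {ι : Type*} [Fintype ι] [DecidableEq ι]
    (H : Matrix ι ι ℂ) (a b : ι) :
    ContDiff ℝ 1 (fun t : ℝ => NormedSpace.exp ((-(Complex.I * (t : ℂ))) • H) a b) := by
  have hexp : ContDiff ℝ 1 (NormedSpace.exp : Matrix ι ι ℂ → Matrix ι ι ℂ) :=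
    contDiff_iff_contDiffAt.2 fun x => (NormedSpace.exp_analytic (𝕂 := ℝ) x).contDiffAt
  have hin : ContDiff ℝ 1 (fun t : ℝ => (-(Complex.I * (t : ℂ))) • H) := by
    have : ContDiff ℝ 1 (fun t : ℝ => (t : ℂ)) := Complex.ofRealCLM.contDiff
    fun_prop
  let ev : Matrix ι ι ℂ →ₗ[ℝ] ℂ :=
    { toFun := fun A => A a b, map_add' := fun _ _ => rfl, map_smul' := fun _ _ => rfl }
  exact (LinearMap.toContinuousLinearMap ev).contDiff.comp (hexp.comp hin)

end MatrixExp

theorem contDiff_list_prod_entry {E ι : Type*} [NormedAddCommGroup E] [NormedSpace ℝ E]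
    [Fintype ι] [DecidableEq ι] (l : List (E → Matrix ι ι ℂ))
    (h : ∀ g ∈ l, ∀ a b, ContDiff ℝ 1 fun x => g x a b) (a b : ι) :
    ContDiff ℝ 1 fun x => (l.map (fun g => g x)).prod a b := by
  induction l generalizing a b with
  | nil => simpa using contDiff_const
  | cons g l ih =>
    simp only [List.map_cons, List.prod_cons, Matrix.mul_apply]
    exact ContDiff.sum fun c _ => (h g (by simp) a c).mul
      (ih (fun g' hg' => h g' (by simp [hg'])) c b)

theorem Ansatz.contDiff_layer_entry (U : Ansatz n r) (j : Fin r) (a b : Qubits n × Qubits n) :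
    ContDiff ℝ 1 fun θ : Param r => U.layer θ j a b := by
  simp only [Ansatz.layer, Matrix.mul_apply]
  refine ContDiff.sum fun c _ => ContDiff.mul ?_ contDiff_const
  exact (contDiff_matrix_exp_smul_entry (U.H j) a c).comp
    (EuclideanSpace.proj (𝕜 := ℝ) j).contDiff

theorem Ansatz.contDiff_unitary_entry (U : Ansatz n r) (a b : Qubits n × Qubits n) :
    ContDiff ℝ 1 fun θ : Param r => U.unitary θ a b := by
  have h := contDiff_list_prod_entry (List.ofFn fun j (θ : Param r) => U.layer θ j).reverse
    (by
      intro g hg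
      simp only [List.mem_reverse, List.mem_ofFn] at hg
      obtain ⟨j, rfl⟩ := hg
      exact U.contDiff_layer_entry j) a b
  simpa only [Ansatz.unitary, List.map_reverse, List.map_ofFn, Function.comp_def] using h

theorem Ansatz.state_apply (U : Ansatz n r) (θ : Param r) (a : Qubits n × Qubits n) :
    U.state θ a = U.unitary θ a (0, 0) := by
  simp [Ansatz.state]

theorem Ansatz.contDiff_expect (U : Ansatz n r) (O : Matrix (Qubits n) (Qubits n) ℂ) :
    ContDiff ℝ 1 (U.expect O) := by
  have hs : ∀ a, ContDiff ℝ 1 fun θ : Param r => U.state θ a := fun a => by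
    simpa only [U.state_apply] using U.contDiff_unitary_entry a (0, 0)
  have hc : ∀ a, ContDiff ℝ 1 fun θ : Param r => star (U.state θ a) := fun a =>
    Complex.conjCLE.contDiff.comp (hs a)
  refine Complex.reCLM.contDiff.comp ?_
  simp only [dotProduct, Matrix.mulVec, Pi.star_apply]
  exact ContDiff.sum fun a _ => (hc a).mul (ContDiff.sum fun b _ => contDiff_const.mul (hs b))

/-! ### Boundedness of expectation values -/

theorem exp_mem_unitaryGroup {ι : Type*} [Fintype ι] [DecidableEq ι] {H : Matrix ι ι ℂ}
    (hH : H.IsHermitian) (t : ℝ) :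
    NormedSpace.exp ((-(Complex.I * (t : ℂ))) • H) ∈ Matrix.unitaryGroup ι ℂ := by
  rw [Matrix.mem_unitaryGroup_iff, Matrix.star_eq_conjTranspose, ← Matrix.exp_conjTranspose]
  have h : ((-(Complex.I * (t : ℂ))) • H).conjTranspose = -((-(Complex.I * (t : ℂ))) • H) := by
    rw [Matrix.conjTranspose_smul, hH.eq]
    simp
  have hc : Commute ((-(Complex.I * (t : ℂ))) • H) (-((-(Complex.I * (t : ℂ))) • H)) :=
    (Commute.refl _).neg_right
  rw [h, ← Matrix.exp_add_of_commute _ _ hc, add_neg_cancel, NormedSpace.exp_zero]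

theorem Ansatz.unitary_mem (U : Ansatz n r) (θ : Param r) :
    U.unitary θ ∈ Matrix.unitaryGroup (Qubits n × Qubits n) ℂ := by
  refine Submonoid.list_prod_mem _ fun g hg => ?_
  simp only [List.mem_reverse, List.mem_ofFn] at hg
  obtain ⟨j, rfl⟩ := hg
  exact mul_mem (exp_mem_unitaryGroup (U.H_hermitian j) (θ j)) (U.W_unitary j)

theorem Ansatz.norm_state_apply_le (U : Ansatz n r) (θ : Param r) (a : Qubits n × Qubits n) :
    ‖U.state θ a‖ ≤ 1 := by
  rw [U.state_apply]
  exact entry_norm_bound_of_unitary (U.unitary_mem θ) _ _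

/-- Unitarity keeps the amplitudes bounded by `1`. Only the existence of a bound matters: it is used
for termination and for a vanishing gradient Lipschitz constant, and never enters `K`. -/
theorem Ansatz.exists_abs_expect_le (U : Ansatz n r) (O : Matrix (Qubits n) (Qubits n) ℂ) :
    ∃ B, ∀ θ, |U.expect O θ| ≤ B := by
  refine ⟨∑ a, ∑ b, ‖((1 : Matrix (Qubits n) (Qubits n) ℂ) ⊗ₖ O) a b‖, fun θ => ?_⟩
  refine (Complex.abs_re_le_norm _).trans ?_
  simp only [dotProduct, Matrix.mulVec, Pi.star_apply]
  refine norm_sum_le_of_le _ fun a _ => ?_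
  rw [norm_mul, norm_star]
  refine (mul_le_of_le_one_left (norm_nonneg _) (U.norm_state_apply_le θ a)).trans ?_
  refine norm_sum_le_of_le _ fun b _ => ?_
  rw [norm_mul]
  exact mul_le_of_le_one_right (norm_nonneg _) (U.norm_state_apply_le θ b)

theorem contDiff_obj (P : SDP n m) (U : Ansatz n r) : ContDiff ℝ 1 (obj P U) :=
  contDiff_const.mul (U.contDiff_expect P.C)

theorem contDiff_constr (P : SDP n m) (U : Ansatz n r) : ContDiff ℝ 1 (constr P U) := by
  refine contDiff_euclidean.2 fun i => ?_
  simp only [constr, PiLp.sub_apply, PiLp.smul_apply, smul_eq_mul]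
  exact (contDiff_const.mul (U.contDiff_expect (P.A i))).sub contDiff_const

theorem exists_abs_obj_le (P : SDP n m) (U : Ansatz n r) : ∃ B, ∀ θ, |obj P U θ| ≤ B := by
  obtain ⟨B, hB⟩ := U.exists_abs_expect_le P.C
  refine ⟨|P.lam| * B, fun θ => ?_⟩
  rw [obj, abs_mul]
  exact mul_le_mul_of_nonneg_left (hB θ) (abs_nonneg _)

theorem exists_norm_constr_le (P : SDP n m) (U : Ansatz n r) : ∃ B, ∀ θ, ‖constr P U θ‖ ≤ B := by
  choose B hB using fun i => U.exists_abs_expect_le (P.A i)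
  refine ⟨|P.lam| * √(∑ i, B i ^ 2) + ‖P.b‖, fun θ => ?_⟩
  refine (norm_sub_le _ _).trans (add_le_add_left ?_ _)
  rw [norm_smul, Real.norm_eq_abs]
  refine mul_le_mul_of_nonneg_left ?_ (abs_nonneg _)
  rw [EuclideanSpace.norm_eq]
  refine Real.sqrt_le_sqrt (Finset.sum_le_sum fun i _ => ?_)
  exact pow_le_pow_left₀ (norm_nonneg _) (hB i θ) 2

theorem contDiff_augLag (P : SDP n m) (U : Ansatz n r) (c : ℝ) (y : Dual m) :
    ContDiff ℝ 1 (augLag P U c y) := by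
  have hA := contDiff_constr P U
  exact ((contDiff_obj P U).add (contDiff_const.inner ℝ hA.neg)).add
    (contDiff_const.mul (hA.neg.norm_sq ℝ))

theorem exists_abs_augLag_le (P : SDP n m) (U : Ansatz n r) (c : ℝ) (y : Dual m) :
    ∃ B, ∀ θ, |augLag P U c y θ| ≤ B := by
  obtain ⟨B₁, h₁⟩ := exists_abs_obj_le P U
  obtain ⟨B₂, h₂⟩ := exists_norm_constr_le P U
  refine ⟨B₁ + ‖y‖ * B₂ + |c / 2| * B₂ ^ 2, fun θ => ?_⟩
  refine (abs_add_three _ _ _).trans (add_le_add_three (h₁ θ) ?_ ?_)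
  · refine (abs_real_inner_le_norm _ _).trans ?_
    rw [norm_neg]
    exact mul_le_mul_of_nonneg_left (h₂ θ) (norm_nonneg _)
  · rw [abs_mul, abs_pow, abs_norm, norm_neg]
    exact mul_le_mul_of_nonneg_left (pow_le_pow_left₀ (norm_nonneg _) (h₂ θ) 2) (abs_nonneg _)

/-! ### The box and derivative bounds -/

theorem convex_box (r : ℕ) : Convex ℝ (box r) := by
  intro x hx z hz a b ha hb hab i
  exact (convex_Icc (0 : ℝ) (2 * Real.pi)) (hx i) (hz i) ha hb hab

theorem interior_box_nonempty (r : ℕ) : (interior (box r)).Nonempty := by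
  refine ⟨WithLp.toLp 2 fun _ => Real.pi, ?_⟩
  refine mem_interior.2 ⟨⋂ i : Fin r, {θ : Param r | θ i ∈ Set.Ioo 0 (2 * Real.pi)}, ?_, ?_, ?_⟩
  · intro θ hθ i
    exact Set.Ioo_subset_Icc_self (Set.mem_iInter.1 hθ i)
  · exact isOpen_iInter_of_finite fun i =>
      isOpen_Ioo.preimage (EuclideanSpace.proj (𝕜 := ℝ) i).continuous
  · refine Set.mem_iInter.2 fun i => ⟨Real.pi_pos, ?_⟩
    change Real.pi < 2 * Real.pi
    linarith [Real.pi_pos]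

theorem norm_sub_le_of_mem_box {x z : Param r} (hx : x ∈ box r) (hz : z ∈ box r) :
    ‖x - z‖ ≤ 2 * Real.pi * √r := by
  rw [EuclideanSpace.norm_eq]
  have h : ∑ i, ‖(x - z) i‖ ^ 2 ≤ (2 * Real.pi) ^ 2 * r := by
    calc ∑ i, ‖(x - z) i‖ ^ 2 ≤ ∑ _i : Fin r, (2 * Real.pi) ^ 2 := by
          refine Finset.sum_le_sum fun i _ => pow_le_pow_left₀ (norm_nonneg _) ?_ 2
          rw [PiLp.sub_apply, Real.norm_eq_abs, abs_le]
          constructor <;> linarith [(hx i).1, (hx i).2, (hz i).1, (hz i).2]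
      _ = (2 * Real.pi) ^ 2 * r := by simp [mul_comm]
  refine (Real.sqrt_le_sqrt h).trans ?_
  rw [Real.sqrt_mul (sq_nonneg _), Real.sqrt_sq (by positivity)]

/-- Iterates may lie on a face of the box, where the set is not a neighbourhood. The bound holds in
the interior and is a closed condition, and a convex set with nonempty interior lies in the closure
of that interior. -/
theorem norm_fderiv_le_of_lipschitzOnWith_convex {E F : Type*} [NormedAddCommGroup E]
    [NormedSpace ℝ E] [NormedAddCommGroup F] [NormedSpace ℝ F] {s : Set E} {f : E → F} {K : ℝ≥0}
    (hs : Convex ℝ s) (hne : (interior s).Nonempty) (hf : ContDiff ℝ 1 f)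
    (hL : LipschitzOnWith K f s) {x : E} (hx : x ∈ s) : ‖fderiv ℝ f x‖ ≤ K := by
  have hcl : IsClosed {x | ‖fderiv ℝ f x‖ ≤ K} :=
    isClosed_le (hf.continuous_fderiv one_ne_zero).norm continuous_const
  have hsub : interior s ⊆ {x | ‖fderiv ℝ f x‖ ≤ K} := fun x hx =>
    norm_fderiv_le_of_lipschitzOn ℝ (mem_interior_iff_mem_nhds.1 hx) hL
  refine closure_minimal hsub hcl ?_
  rw [hs.closure_interior_eq_closure_of_nonempty_interior hne]
  exact subset_closure hx

/-! ### The gradient of the augmented Lagrangian -/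

theorem gradLag_eq (P : SDP n m) (U : Ansatz n r) (c : ℝ) (y : Dual m) (θ : Param r) :
    gradLag P U c y θ = gradient (obj P U) θ -
      ContinuousLinearMap.adjoint (fderiv ℝ (constr P U) θ) (y - c • constr P U θ) := by
  have hf := ((contDiff_obj P U).differentiable one_ne_zero θ).hasFDerivAt
  have hA := ((contDiff_constr P U).differentiable one_ne_zero θ).hasFDerivAt
  have h := (hf.add ((hasFDerivAt_const y θ).inner ℝ hA.neg)).add
    ((hA.neg.norm_sq).const_mul (c / 2))
  refine ext_inner_right ℝ fun v => ?_
  have h1 : inner ℝ (gradLag P U c y θ) v = fderiv ℝ (augLag P U c y) θ v := by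
    simp [gradLag, gradient]
  have h2 : inner ℝ (gradient (obj P U) θ) v = fderiv ℝ (obj P U) θ v := by simp [gradient]
  have h3 : fderiv ℝ (augLag P U c y) θ = _ := h.fderiv
  rw [h1, h3, inner_sub_left, h2, ContinuousLinearMap.adjoint_inner_left]
  simp [inner_sub_left, inner_smul_left]
  ring

/-- The gradient depends on `c` and `y` only through `y - c A(θ)`. -/
theorem gradLag_add_smul_constr (P : SDP n m) (U : Ansatz n r) (c d : ℝ) (y : Dual m)
    (θ : Param r) :
    gradLag P U (c + d) (y + d • constr P U θ) θ = gradLag P U c y θ := by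
  rw [gradLag_eq, gradLag_eq]
  congr 2
  module

theorem gradLag_dual_step (P : SDP n m) (U : Ansatz n r) (c d : ℝ) (y : Dual m) (θ : Param r) :
    gradLag P U c (y + d • constr P U θ) θ = gradLag P U c y θ - d • jacTConstr P U θ := by
  rw [gradLag_eq, gradLag_eq, jacTConstr, ← map_smul, sub_sub, ← map_add]
  congr 2
  module

/-- The dual variable in the definition is free, so it can compensate any change of penalty
parameter; this allows passing from `c_{k-1}` to `c_k`. -/
theorem isStationary_of_gradLag_le {P : SDP n m} {U : Ansatz n r} {ε c : ℝ} {y : Dual m}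
    {θ : Param r} (hθ : θ ∈ box r) (hg : ‖gradLag P U c y θ‖ ≤ ε) (hA : ‖constr P U θ‖ ≤ ε)
    (c' : ℝ) : IsStationary P U ε c' θ := by
  refine ⟨hθ, y + (c' - c) • constr P U θ, ?_, hA⟩
  have h := gradLag_add_smul_constr P U c (c' - c) y θ
  rw [add_sub_cancel] at h
  rwa [h]

section Lipschitz

variable {P : SDP n m} {U : Ansatz n r} {Lf LA : ℝ≥0} {θ : Param r}

theorem norm_gradient_obj_le (hf : LipschitzOnWith Lf (obj P U) (box r)) (hθ : θ ∈ box r) :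
    ‖gradient (obj P U) θ‖ ≤ Lf := by
  rw [gradient, LinearIsometryEquiv.norm_map]
  exact norm_fderiv_le_of_lipschitzOnWith_convex (convex_box r) (interior_box_nonempty r)
    (contDiff_obj P U) hf hθ

theorem norm_adjoint_fderiv_constr_le (hA : LipschitzOnWith LA (constr P U) (box r))
    (hθ : θ ∈ box r) (y : Dual m) :
    ‖ContinuousLinearMap.adjoint (fderiv ℝ (constr P U) θ) y‖ ≤ LA * ‖y‖ := by
  refine (ContinuousLinearMap.le_opNorm _ _).trans
    (mul_le_mul_of_nonneg_right ?_ (norm_nonneg _))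
  rw [LinearIsometryEquiv.norm_map]
  exact norm_fderiv_le_of_lipschitzOnWith_convex (convex_box r) (interior_box_nonempty r)
    (contDiff_constr P U) hA hθ

theorem mul_norm_jacTConstr_le (hf : LipschitzOnWith Lf (obj P U) (box r))
    (hA : LipschitzOnWith LA (constr P U) (box r)) (hθ : θ ∈ box r) {c : ℝ} (hc : 0 ≤ c)
    (y : Dual m) :
    c * ‖jacTConstr P U θ‖ ≤ ‖gradLag P U c y θ‖ + Lf + LA * ‖y‖ := by
  have h : c • jacTConstr P U θ = gradLag P U c y θ - gradient (obj P U) θ +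
      ContinuousLinearMap.adjoint (fderiv ℝ (constr P U) θ) y := by
    rw [gradLag_eq, jacTConstr, map_sub, map_smul]
    abel
  calc c * ‖jacTConstr P U θ‖ = ‖c • jacTConstr P U θ‖ := by
        rw [norm_smul, Real.norm_of_nonneg hc]
    _ ≤ _ := by
        rw [h]
        exact (norm_add_le _ _).trans (add_le_add ((norm_sub_le _ _).trans
          (add_le_add_right (norm_gradient_obj_le hf hθ) _))
          (norm_adjoint_fderiv_constr_le hA hθ y))

/-- The penalty has a positive sign under maximization. At the start `z` it can be dropped; at the
end `x` it survives and has to be controlled by feasibility. -/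
theorem augLag_sub_le (hf : LipschitzOnWith Lf (obj P U) (box r))
    (hA : LipschitzOnWith LA (constr P U) (box r)) {x z : Param r} (hx : x ∈ box r)
    (hz : z ∈ box r) {c : ℝ} (hc : 0 ≤ c) (y : Dual m) :
    augLag P U c y x - augLag P U c y z ≤
      (Lf + ‖y‖ * LA) * (2 * Real.pi * √r) + c / 2 * ‖constr P U x‖ ^ 2 := by
  have hd := norm_sub_le_of_mem_box hx hz
  have h1 : obj P U x - obj P U z ≤ Lf * (2 * Real.pi * √r) := by
    refine (le_abs_self _).trans ?_
    have := hf.dist_le_mul x hx z hz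
    rw [Real.dist_eq, dist_eq_norm] at this
    exact this.trans (mul_le_mul_of_nonneg_left hd Lf.2)
  have h2 : inner ℝ y (-constr P U x) - inner ℝ y (-constr P U z) ≤
      ‖y‖ * (LA * (2 * Real.pi * √r)) := by
    rw [← inner_sub_right]
    refine (real_inner_le_norm _ _).trans (mul_le_mul_of_nonneg_left ?_ (norm_nonneg _))
    rw [neg_sub_neg, norm_sub_rev]
    have := hA.dist_le_mul x hx z hz
    rw [dist_eq_norm, dist_eq_norm] at this
    exact this.trans (mul_le_mul_of_nonneg_left hd LA.2)
  have h3 : 0 ≤ c / 2 * ‖constr P U z‖ ^ 2 := by positivity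
  simp only [augLag, norm_neg]
  linarith

theorem norm_constr_le_add (hA : LipschitzOnWith LA (constr P U) (box r)) {x z : Param r}
    (hx : x ∈ box r) (hz : z ∈ box r) :
    ‖constr P U x‖ ≤ ‖constr P U z‖ + LA * (2 * Real.pi * √r) := by
  have := hA.dist_le_mul x hx z hz
  rw [dist_eq_norm, dist_eq_norm] at this
  have h := this.trans (mul_le_mul_of_nonneg_left (norm_sub_le_of_mem_box hx hz) LA.2)
  linarith [norm_le_norm_add_norm_sub' (constr P U x) (constr P U z)]

end Lipschitz

/-! ### The accelerated proximal gradient method -/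

/-- Mean value inequality on the ball of radius `α ‖∇F(x)‖`, where the derivative varies by at most
`L α ‖∇F(x)‖`. The usual factor `1/2` in the error is given up; `L α < 1` still yields a gain. -/
theorem le_apply_add_smul_gradient {E : Type*} [NormedAddCommGroup E] [InnerProductSpace ℝ E]
    [CompleteSpace E] {F : E → ℝ} (hF : Differentiable ℝ F) {L : ℝ≥0}
    (hL : LipschitzWith L (gradient F)) (x : E) {α : ℝ} (hα : 0 ≤ α) :
    F x + α * (1 - L * α) * ‖gradient F x‖ ^ 2 ≤ F (x + α • gradient F x) := by
  set g := gradient F x with hg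
  have hmem : x + α • g ∈ Metric.closedBall x (α * ‖g‖) := by
    rw [Metric.mem_closedBall, dist_eq_norm, add_sub_cancel_left, norm_smul,
      Real.norm_of_nonneg hα]
  have hbd := (convex_closedBall x (α * ‖g‖)).norm_image_sub_le_of_norm_fderiv_le' (𝕜 := ℝ)
    (f := F) (φ := fderiv ℝ F x) (C := L * (α * ‖g‖)) (fun z _ => hF z)
    (fun z hz => by
      have h : ‖fderiv ℝ F z - fderiv ℝ F x‖ = ‖gradient F z - gradient F x‖ := by
        rw [gradient, gradient, ← map_sub, LinearIsometryEquiv.norm_map]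
      rw [h]
      have := hL.dist_le_mul z x
      rw [dist_eq_norm] at this
      exact this.trans (mul_le_mul_of_nonneg_left (Metric.mem_closedBall.1 hz) L.2))
    (Metric.mem_closedBall_self (by positivity)) hmem
  have h1 : fderiv ℝ F x (α • g) = α * ‖g‖ ^ 2 := by
    have : fderiv ℝ F x g = inner ℝ (gradient F x) g := by simp [gradient]
    rw [map_smul, this, ← hg, real_inner_self_eq_norm_sq, smul_eq_mul]
  rw [add_sub_cancel_left, h1, norm_smul, Real.norm_of_nonneg hα, Real.norm_eq_abs] at hbd
  nlinarith [(abs_le.1 hbd).1]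

theorem apgIter_succ_ge {F : Param r → ℝ} (hF : Differentiable ℝ F) {L : ℝ≥0}
    (hL : LipschitzWith L (gradient F)) {αx : ℝ} (hα : 0 ≤ αx) (αy : ℝ) (s : Param r) (j : ℕ) :
    F (apgIter F αx αy s j) + αx * (1 - L * αx) * ‖gradient F (apgIter F αx αy s j)‖ ^ 2 ≤
      F (apgIter F αx αy s (j + 1)) := by
  refine (le_apply_add_smul_gradient hF hL _ hα).trans ?_
  simp only [apgIter, Function.iterate_succ_apply']
  -- The gain comes from the plain gradient step `v` alone, so the momentum part of the state is
  -- irrelevant.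
  generalize (apgStep F αx αy)^[j] _ = S
  simp only [apgStep]
  split_ifs with h
  · exact h
  · exact le_rfl

theorem apgIter_descent {F : Param r → ℝ} (hF : Differentiable ℝ F) {L : ℝ≥0}
    (hL : LipschitzWith L (gradient F)) {αx : ℝ} (hα : 0 ≤ αx) (hαL : L * αx ≤ 1) (αy : ℝ)
    (s : Param r) {δ : ℝ} (hδ : 0 ≤ δ) (N : ℕ)
    (h : ∀ j < N, δ ≤ ‖gradient F (apgIter F αx αy s j)‖) :
    N * (αx * (1 - L * αx) * δ ^ 2) ≤ F (apgIter F αx αy s N) - F s := by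
  induction N with
  | zero => simp [apgIter]
  | succ N ih =>
    have h1 := ih fun j hj => h j (hj.trans N.lt_succ_self)
    have h2 := apgIter_succ_ge hF hL hα αy s N
    have h3 : αx * (1 - L * αx) * δ ^ 2 ≤
        αx * (1 - L * αx) * ‖gradient F (apgIter F αx αy s N)‖ ^ 2 :=
      mul_le_mul_of_nonneg_left (pow_le_pow_left₀ hδ (h N N.lt_succ_self) 2)
        (mul_nonneg hα (by linarith))
    push_cast
    linarith

/-- A nonzero constant gradient would make `F` unbounded. This covers the degenerate case in which
both step sizes are `τ / 0 = 0`. -/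
theorem gradient_eq_zero_of_lipschitzWith_zero {E : Type*} [NormedAddCommGroup E]
    [InnerProductSpace ℝ E] [CompleteSpace E] {F : E → ℝ} (hF : Differentiable ℝ F)
    (hL : LipschitzWith 0 (gradient F)) {B : ℝ} (hB : ∀ x, |F x| ≤ B) (x : E) :
    gradient F x = 0 := by
  by_contra hne
  have hpos : 0 < ‖gradient F x‖ ^ 2 := by positivity
  have hB0 : 0 ≤ B := (abs_nonneg _).trans (hB x)
  have h := le_apply_add_smul_gradient hF hL x
    -- This step length gains `2 * B + 1`, more than the range of `F` permits.
    (α := (2 * B + 1) / ‖gradient F x‖ ^ 2) (by positivity)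
  rw [NNReal.coe_zero, zero_mul, sub_zero, mul_one, div_mul_cancel₀ _ hpos.ne'] at h
  linarith [(abs_le.1 (hB x)).1, (le_abs_self _).trans (hB (x +
    ((2 * B + 1) / ‖gradient F x‖ ^ 2) • gradient F x))]

section Solver

variable {P : SDP n m} {U : Ansatz n r} {L : ℝ → Dual m → ℝ≥0} {τx : ℝ} {c : ℝ} {y : Dual m}

theorem gradLag_eq_zero_of_lipschitz_zero (hL : LipschitzWith (L c y) (gradLag P U c y))
    (h0 : L c y = 0) (θ : Param r) : gradLag P U c y θ = 0 := by
  obtain ⟨B, hB⟩ := exists_abs_augLag_le P U c y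
  rw [h0] at hL
  exact gradient_eq_zero_of_lipschitzWith_zero
    ((contDiff_augLag P U c y).differentiable one_ne_zero) hL hB θ

/-- While the gradient is at least `δ`, each iteration gains at least a multiple of `δ ^ 2`. -/
theorem solverIter_descent (hL : LipschitzWith (L c y) (gradLag P U c y)) (hpos : L c y ≠ 0)
    (hτx : τx ∈ Set.Ioo (0 : ℝ) 1) (τy : ℝ) (s : Param r) {δ : ℝ} (hδ : 0 ≤ δ) (N : ℕ)
    (h : ∀ j < N, δ ≤ ‖gradLag P U c y (solverIter P U τx τy L c y s j)‖) :
    N * (τx * (1 - τx) * δ ^ 2) ≤ L c y *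
      (augLag P U c y (solverIter P U τx τy L c y s N) - augLag P U c y s) := by
  have hl : 0 < (L c y : ℝ) := NNReal.coe_pos.2 (pos_iff_ne_zero.2 hpos)
  have hmul : (L c y : ℝ) * (τx / L c y) = τx := mul_div_cancel₀ _ hl.ne'
  have hd := apgIter_descent ((contDiff_augLag P U c y).differentiable one_ne_zero) hL
    (div_nonneg hτx.1.le hl.le) (hmul.trans_le hτx.2.le) (τy / L c y) s hδ N h
  rw [hmul] at hd
  have := mul_le_mul_of_nonneg_left hd hl.le
  refine le_trans (le_of_eq ?_) this
  field_simp

theorem exists_solverIter_le (hL : LipschitzWith (L c y) (gradLag P U c y))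
    (hτx : τx ∈ Set.Ioo (0 : ℝ) 1) (τy : ℝ) (s : Param r) {δ : ℝ} (hδ : 0 < δ) :
    ∃ j, ‖gradLag P U c y (solverIter P U τx τy L c y s j)‖ ≤ δ := by
  by_cases h0 : L c y = 0
  · exact ⟨0, by rw [gradLag_eq_zero_of_lipschitz_zero hL h0, norm_zero]; exact hδ.le⟩
  by_contra! hcon
  obtain ⟨B, hB⟩ := exists_abs_augLag_le P U c y
  have hτ : 0 < τx * (1 - τx) * δ ^ 2 := by
    have := sub_pos.2 hτx.2
    have := hτx.1
    positivity
  obtain ⟨N, hN⟩ := exists_nat_gt (L c y * (2 * B) / (τx * (1 - τx) * δ ^ 2))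
  rw [div_lt_iff₀ hτ] at hN
  have hd := solverIter_descent hL h0 hτx τy s hδ.le N fun j _ => (hcon j).le
  refine absurd (hN.trans_le hd) (not_lt.2 (mul_le_mul_of_nonneg_left ?_ (L c y).2))
  linarith [(le_abs_self _).trans (hB (solverIter P U τx τy L c y s N)), (abs_le.1 (hB s)).1]

end Solver

/-! ### Boundedness of the dual iterates -/

/-- A telescoping majorant: `1 / (k + 2)` is at most the increment of `log`, and `4 / 3` bounds `(k
+ 2) / (k + 1)` for `k ≥ 2`. -/
theorem one_div_mul_log_sq_le {k : ℕ} (hk : 2 ≤ k) :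
    1 / (((k : ℝ) + 1) * Real.log ((k : ℝ) + 2) ^ 2) ≤
      4 / 3 * (1 / Real.log ((k : ℝ) + 1) - 1 / Real.log ((k : ℝ) + 2)) := by
  have hk' : (2 : ℝ) ≤ k := by exact_mod_cast hk
  have hp : 0 < Real.log ((k : ℝ) + 1) := Real.log_pos (by linarith)
  have hpq : Real.log ((k : ℝ) + 1) ≤ Real.log ((k : ℝ) + 2) :=
    Real.log_le_log (by linarith) (by linarith)
  have hdiff : 1 / ((k : ℝ) + 2) ≤ Real.log ((k : ℝ) + 2) - Real.log ((k : ℝ) + 1) := by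
    rw [← Real.log_div (by positivity) (by positivity)]
    refine le_trans (le_of_eq ?_) (Real.one_sub_inv_le_log_of_pos (by positivity))
    field_simp
    ring
  set p := Real.log ((k : ℝ) + 1)
  set q := Real.log ((k : ℝ) + 2)
  have hq : 0 < q := hp.trans_le hpq
  calc 1 / (((k : ℝ) + 1) * q ^ 2) ≤ 4 / 3 * (1 / ((k : ℝ) + 2)) / q ^ 2 := by
        rw [← div_div]
        refine div_le_div_of_nonneg_right ?_ (by positivity)
        rw [← mul_div_assoc, div_le_div_iff₀ (by positivity) (by positivity)]
        linarith
    _ ≤ 4 / 3 * (q - p) / (p * q) := by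
        refine div_le_div₀ (by nlinarith [sub_nonneg.2 hpq]) (by linarith) (by positivity) ?_
        nlinarith
    _ = 4 / 3 * (1 / p - 1 / q) := by field_simp

section Run

variable {P : SDP n m} {U : Ansatz n r} {μ η₁ : ℝ} {k₁ : ℕ} {θ : ℕ → Param r}
  {y : ℕ → Dual m} {η : ℕ → ℝ}

theorem yMax_nonneg (P : SDP n m) (U : Ansatz n r) (hη₁ : 0 ≤ η₁) (θ : ℕ → Param r)
    (y : ℕ → Dual m) : 0 ≤ yMax P U η₁ θ y := by
  unfold yMax
  positivity

theorem IsRun.eta_mem (h : IsRun P U μ η₁ k₁ θ y η) (hη₁ : 0 ≤ η₁) {k : ℕ} (h1 : 1 ≤ k)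
    (hk : k ≤ k₁) : η k ∈ Set.Icc 0 η₁ := by
  obtain rfl | h2 := h1.eq_or_lt
  · rw [h.eta_one]
    exact ⟨hη₁, le_rfl⟩
  obtain ⟨k, rfl⟩ : ∃ i, k = i + 1 := ⟨k - 1, by omega⟩
  rw [h.eta_step k (by omega) (by omega)]
  split_ifs
  · simpa using hη₁
  · have h0 : 0 ≤ ‖constr P U (θ 1)‖ * Real.log 2 ^ 2 /
        (‖constr P U (θ (k + 1))‖ * ((k : ℝ) + 1) * Real.log ((k : ℝ) + 2) ^ 2) :=
      div_nonneg (mul_nonneg (norm_nonneg _) (sq_nonneg _)) (mul_nonneg (mul_nonneg (norm_nonneg _)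
        (by linarith [k.cast_nonneg (α := ℝ)])) (sq_nonneg _))
    exact ⟨mul_nonneg hη₁ (le_min h0 zero_le_one), mul_le_of_le_one_right hη₁ (min_le_right _ _)⟩

/-- The first entry of the minimum divides by `‖A(θ^{k+1})‖`, so that norm cancels. -/
theorem IsRun.norm_dual_increment_le (h : IsRun P U μ η₁ k₁ θ y η) (hη₁ : 0 ≤ η₁) {k : ℕ}
    (h1 : 1 ≤ k) (hk : k < k₁) :
    ‖η (k + 1) • constr P U (θ (k + 1))‖ ≤
      yMax P U η₁ θ y * (1 / (((k : ℝ) + 1) * Real.log ((k : ℝ) + 2) ^ 2)) := by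
  by_cases hA : constr P U (θ (k + 1)) = 0
  · rw [hA, smul_zero, norm_zero]
    exact mul_nonneg (yMax_nonneg P U hη₁ θ y) (by positivity)
  have hpos : 0 < ‖constr P U (θ (k + 1))‖ := norm_pos_iff.2 hA
  rw [norm_smul, Real.norm_of_nonneg (h.eta_mem hη₁ (by omega) hk).1, h.eta_step k h1 hk,
    if_neg hA]
  calc _ ≤ η₁ * (‖constr P U (θ 1)‖ * Real.log 2 ^ 2 /
        (‖constr P U (θ (k + 1))‖ * ((k : ℝ) + 1) * Real.log ((k : ℝ) + 2) ^ 2)) *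
        ‖constr P U (θ (k + 1))‖ :=
        mul_le_mul_of_nonneg_right (mul_le_mul_of_nonneg_left (min_le_left _ _) hη₁)
          (norm_nonneg _)
    _ = _ := by
        have : 0 < Real.log ((k : ℝ) + 2) := Real.log_pos (by linarith [k.cast_nonneg (α := ℝ)])
        rw [yMax, h.y_zero, norm_zero, zero_add]
        field_simp

/-- The bound is not `yMax` itself:
`∑ 1 / (j ln² (j + 1))` over `j ≥ 2` exceeds `1`. -/
theorem IsRun.norm_dual_le (h : IsRun P U μ η₁ k₁ θ y η) (hη₁ : 0 ≤ η₁) {k : ℕ} (h1 : 1 ≤ k)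
    (hk : k ≤ k₁) : ‖y k‖ ≤ 2 * yMax P U η₁ θ y := by
  have hY := yMax_nonneg P U hη₁ θ y
  have hy1 : y 1 = 0 := h.y_one.trans h.y_zero
  -- The induction needs the stronger bound with the telescoping remainder subtracted. At `j = 2` it
  -- holds because `log 3 ≥ 1`.
  have key : ∀ j, 2 ≤ j → j ≤ k₁ →
      ‖y j‖ ≤ yMax P U η₁ θ y * (2 - 4 / 3 * (1 / Real.log ((j : ℝ) + 1))) := by
    intro j hj
    induction j, hj using Nat.le_induction with
    | base =>
      intro hk₁
      have hs := h.norm_dual_increment_le hη₁ le_rfl (by omega : 1 < k₁)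
      rw [h.dual_step 1 le_rfl (by omega), hy1, zero_add]
      refine hs.trans (mul_le_mul_of_nonneg_left ?_ hY)
      have h3 : 1 ≤ Real.log 3 := by
        rw [Real.le_log_iff_exp_le (by norm_num)]
        linarith [Real.exp_one_lt_d9]
      have hu : 1 / Real.log 3 ≤ 1 := by
        rw [div_le_one (by linarith)]
        exact h3
      have hu0 : 0 ≤ 1 / Real.log 3 := by positivity
      have he : 1 / ((((1 : ℕ) : ℝ) + 1) * Real.log (((1 : ℕ) : ℝ) + 2) ^ 2) =
          1 / 2 * (1 / Real.log 3) ^ 2 := by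
        norm_num
        ring
      rw [he]
      have hc : ((2 : ℕ) : ℝ) + 1 = 3 := by norm_num
      rw [hc]
      nlinarith
    | succ j hj ih =>
      intro hjk
      rw [h.dual_step j (by omega) (by omega)]
      have hs := h.norm_dual_increment_le hη₁ (by omega : 1 ≤ j) (by omega)
      have hl := mul_le_mul_of_nonneg_left (one_div_mul_log_sq_le hj) hY
      have hcast : (((j + 1 : ℕ) : ℝ) + 1) = (j : ℝ) + 2 := by
        push_cast
        ring
      rw [hcast]
      linarith [norm_add_le (y j) (η (j + 1) • constr P U (θ (j + 1))), ih (by omega)]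
  obtain rfl | h2 := h1.eq_or_lt
  · rw [hy1, norm_zero]
    positivity
  · refine (key k h2 hk).trans ?_
    have : 0 ≤ 1 / Real.log ((k : ℝ) + 1) :=
      one_div_nonneg.2 (Real.log_nonneg (by linarith [k.cast_nonneg (α := ℝ)]))
    nlinarith

/-! ### Feasibility, stationarity and the stopping test -/

variable {ν : ℝ} {Lf LA : ℝ≥0}

/-- The factor `2` has two sources: the tolerance `1 / c` is absorbed into a second `Lf`, and the
dual bound is `2 * yMax`. -/
theorem IsRun.norm_constr_le (h : IsRun P U μ η₁ k₁ θ y η) (hη₁ : 0 ≤ η₁) (hμ : 1 < μ)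
    (hν : 0 < ν) (hf : LipschitzOnWith Lf (obj P U) (box r))
    (hA : LipschitzOnWith LA (constr P U) (box r)) {k : ℕ} (h2 : 2 ≤ k) (hk : k ≤ k₁)
    (hLf : 1 / μ ^ (k - 1) ≤ (Lf : ℝ)) (hθ : θ k ∈ box r)
    (hreg : ν * ‖constr P U (θ k)‖ ≤ ‖-jacTConstr P U (θ k)‖) :
    ‖constr P U (θ k)‖ ≤ 1 / μ ^ (k - 1) * (2 * (Lf + yMax P U η₁ θ y * LA) / ν) := by
  obtain ⟨k, rfl⟩ : ∃ i, k = i + 1 := ⟨k - 1, by omega⟩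
  rw [Nat.add_sub_cancel] at hLf ⊢
  have hc : 0 < μ ^ k := pow_pos (by linarith) k
  have h1 := mul_norm_jacTConstr_le hf hA hθ hc.le (y k)
  have h3 := h.inexact k (by omega) (by omega)
  have h4 := mul_le_mul_of_nonneg_left (h.norm_dual_le hη₁ (by omega : 1 ≤ k) (by omega)) LA.2
  rw [norm_neg] at hreg
  have h5 := mul_le_mul_of_nonneg_left hreg hc.le
  have h4' : (LA : ℝ) * ‖y k‖ ≤ LA * (2 * yMax P U η₁ θ y) := h4
  rw [div_mul_div_comm, one_mul, le_div_iff₀ (by positivity)]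
  linarith

theorem IsRun.residual_le (h : IsRun P U μ η₁ k₁ θ y η) (hη₁ : 0 ≤ η₁) (hμ : 1 < μ)
    (hν : 0 < ν) (hf : LipschitzOnWith Lf (obj P U) (box r))
    (hA : LipschitzOnWith LA (constr P U) (box r)) {k : ℕ} (h2 : 2 ≤ k) (hk : k ≤ k₁)
    (hLf : 1 / μ ^ (k - 1) ≤ (Lf : ℝ)) (hθ : θ k ∈ box r)
    (hreg : ν * ‖constr P U (θ k)‖ ≤ ‖-jacTConstr P U (θ k)‖) :
    ‖gradLag P U (μ ^ (k - 1)) (y k) (θ k)‖ + ‖constr P U (θ k)‖ ≤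
      1 / μ ^ (k - 1) * constQ Lf LA (yMax P U η₁ θ y) ν (η k) := by
  have hc := h.norm_constr_le hη₁ hμ hν hf hA h2 hk hLf hθ hreg
  have hη := h.eta_mem hη₁ (by omega : 1 ≤ k) hk
  have hg : ‖gradLag P U (μ ^ (k - 1)) (y k) (θ k)‖ ≤
      1 / μ ^ (k - 1) + η k * (LA * ‖constr P U (θ k)‖) := by
    obtain ⟨i, rfl⟩ : ∃ i, k = i + 1 := ⟨k - 1, by omega⟩
    rw [Nat.add_sub_cancel, h.dual_step i (by omega) (by omega), gradLag_dual_step]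
    refine (norm_sub_le _ _).trans (add_le_add (h.inexact i (by omega) (by omega)) ?_)
    rw [norm_smul, Real.norm_of_nonneg hη.1]
    exact mul_le_mul_of_nonneg_left (norm_adjoint_fderiv_constr_le hA hθ _) hη.1
  have hm := mul_le_mul_of_nonneg_left hc
    (add_nonneg zero_le_one (mul_nonneg hη.1 LA.2) : (0 : ℝ) ≤ 1 + η k * (LA : ℝ))
  have he : 1 / μ ^ (k - 1) * constQ Lf LA (yMax P U η₁ θ y) ν (η k) = 1 / μ ^ (k - 1) +
      (1 + η k * LA) * (1 / μ ^ (k - 1) * (2 * (Lf + yMax P U η₁ θ y * LA) / ν)) := by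
    rw [constQ]
    ring
  rw [he]
  linarith

theorem constQ_mono (Lf LA : ℝ≥0) {ymax η η' : ℝ} (hy : 0 ≤ ymax) (hν : 0 < ν) (h : η ≤ η') :
    constQ Lf LA ymax ν η ≤ constQ Lf LA ymax ν η' := by
  unfold constQ
  gcongr

theorem one_le_constQ (Lf LA : ℝ≥0) {ymax η : ℝ} (hy : 0 ≤ ymax) (hν : 0 < ν) (h : 0 ≤ η) :
    1 ≤ constQ Lf LA ymax ν η := by
  unfold constQ
  have : 0 ≤ 2 * ((Lf : ℝ) + ymax * LA) * (1 + η * LA) / ν := by positivity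
  linarith

theorem StopTest.isStationary {ε : ℝ} {k : ℕ} (h : StopTest P U μ ε θ y k) (hθ : θ k ∈ box r)
    (c : ℝ) : IsStationary P U ε c (θ k) := by
  unfold StopTest at h
  exact isStationary_of_gradLag_le hθ (by linarith [norm_nonneg (constr P U (θ k))])
    (by linarith [norm_nonneg (gradLag P U (μ ^ (k - 1)) (y k) (θ k))]) c

end Run

/-! ### Iteration counts of the solver -/

theorem sum_pow_Icc_le {q : ℝ} (hq : 1 < q) (k : ℕ) :
    ∑ j ∈ Finset.Icc 1 k, q ^ j ≤ q / (q - 1) * q ^ k := by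
  have hq' : 0 < q - 1 := sub_pos.2 hq
  induction k with
  | zero =>
    simp only [Finset.Icc_eq_empty_of_lt zero_lt_one, Finset.sum_empty]
    positivity
  | succ k ih =>
    rw [Finset.sum_Icc_succ_top (by omega)]
    refine (add_le_add_left ih _).trans (le_of_eq ?_)
    field_simp
    ring

/-- A bound, uniform over the circuit and the run, for the number of solver iterations in one pass
divided by `r c_k ^ 3`. -/
def iterConst (μ ν Y Γ τx : ℝ) (Lf LA : ℝ≥0) (k₀ : ℕ) : ℝ :=
  |Γ| * (2 + 2 * |Y|) * ((Lf + 2 * |Y| * LA) * (2 * Real.pi) +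
    μ ^ k₀ * (2 * (Lf + |Y| * LA) / ν + LA * (2 * Real.pi)) ^ 2) / (τx * (1 - τx))

theorem iterConst_nonneg {μ ν Y Γ τx : ℝ} {Lf LA : ℝ≥0} {k₀ : ℕ} (hμ : 1 < μ)
    (hτx : τx ∈ Set.Ioo (0 : ℝ) 1) : 0 ≤ iterConst μ ν Y Γ τx Lf LA k₀ := by
  have h1 := hτx.1
  have h2 := sub_pos.2 hτx.2
  unfold iterConst
  positivity

section Complexity

variable {P : SDP n m} {U : Ansatz n r} {μ η₁ ν Y Γ τx τy : ℝ} {Lf LA : ℝ≥0} {k₀ k₁ : ℕ}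
  {L : ℝ → Dual m → ℝ≥0} {θ s : ℕ → Param r} {y : ℕ → Dual m} {η : ℕ → ℝ} {N : ℕ → ℕ}

theorem one_div_pow_le_of_le (hμ : 1 < μ) (hLf : 1 / μ ^ (k₀ - 1) ≤ (Lf : ℝ)) {k : ℕ}
    (hk : k₀ ≤ k) : 1 / μ ^ (k - 1) ≤ (Lf : ℝ) :=
  (one_div_le_one_div_of_le (pow_pos (by linarith) _)
    (pow_le_pow_right₀ hμ.le (by omega))).trans hLf

/-- This controls the penalty part of the gap. From index `k₀` on, feasibility is `O(1/c)` and the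
term even decays; before that, regularity is not assumed and the bound is carried over from `θ k₀`
across the box. -/
theorem IsRun.pow_mul_norm_constr_sq_le (h : IsRun P U μ η₁ k₁ θ y η) (hη₁ : 0 ≤ η₁)
    (hμ : 1 < μ) (hν : 0 < ν) (hk₀ : 2 ≤ k₀) (hk₀₁ : k₀ ≤ k₁) (hr : 1 ≤ r)
    (hLf : 1 / μ ^ (k₀ - 1) ≤ (Lf : ℝ)) (hf : LipschitzOnWith Lf (obj P U) (box r))
    (hA : LipschitzOnWith LA (constr P U) (box r))
    (hreg : ∀ k ∈ Set.Icc k₀ k₁, ν * ‖constr P U (θ k)‖ ≤ ‖-jacTConstr P U (θ k)‖)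
    (hbox : ∀ k ∈ Set.Icc 1 k₁, θ k ∈ box r) (hY : yMax P U η₁ θ y ≤ Y) {k : ℕ} (h1 : 1 ≤ k)
    (hk : k < k₁) :
    μ ^ k * ‖constr P U (θ (k + 1))‖ ^ 2 ≤
      μ ^ k₀ * (2 * (Lf + |Y| * LA) / ν + LA * (2 * Real.pi)) ^ 2 * r := by
  set G : ℝ := 2 * (Lf + |Y| * LA) / ν with hG
  have hG0 : 0 ≤ G := by positivity
  have hr' : (1 : ℝ) ≤ r := by exact_mod_cast hr
  have hsq : (1 : ℝ) ≤ √r := Real.one_le_sqrt.2 hr'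
  have hμ0 : 0 < μ := by linarith
  have hle : ∀ j ∈ Set.Icc k₀ k₁, ‖constr P U (θ j)‖ ≤ 1 / μ ^ (j - 1) * G := by
    intro j hj
    refine (h.norm_constr_le hη₁ hμ hν hf hA (hk₀.trans hj.1) hj.2
      (one_div_pow_le_of_le hμ hLf hj.1) (hbox j ⟨by linarith [hj.1], hj.2⟩) (hreg j hj)).trans ?_
    have := hY.trans (le_abs_self Y)
    rw [hG]
    gcongr
  by_cases hkk : k₀ ≤ k + 1
  · have h2 := hle (k + 1) ⟨hkk, hk⟩
    rw [Nat.add_sub_cancel] at h2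
    have hc1 : 1 ≤ μ ^ k := one_le_pow₀ hμ.le
    calc μ ^ k * ‖constr P U (θ (k + 1))‖ ^ 2 ≤ μ ^ k * (1 / μ ^ k * G) ^ 2 := by gcongr
      _ = 1 / μ ^ k * G ^ 2 := by field_simp
      _ ≤ 1 * G ^ 2 := by
          gcongr
          exact (div_le_one (by positivity)).2 hc1
      _ ≤ μ ^ k₀ * (G + LA * (2 * Real.pi)) ^ 2 := by
          gcongr
          · exact one_le_pow₀ hμ.le
          · exact le_add_of_nonneg_right (by positivity)
      _ ≤ _ := le_mul_of_one_le_right (by positivity) hr'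
  · have h2 := hle k₀ ⟨le_rfl, hk₀₁⟩
    have h3 : ‖constr P U (θ k₀)‖ ≤ G := h2.trans (mul_le_of_le_one_left hG0
      ((div_le_one (by positivity)).2 (one_le_pow₀ hμ.le)))
    have h4 := norm_constr_le_add hA (hbox (k + 1) ⟨by omega, hk⟩) (hbox k₀ ⟨by omega, hk₀₁⟩)
    have h5 : ‖constr P U (θ (k + 1))‖ ≤ (G + LA * (2 * Real.pi)) * √r := by nlinarith
    calc μ ^ k * ‖constr P U (θ (k + 1))‖ ^ 2
        ≤ μ ^ k₀ * ((G + LA * (2 * Real.pi)) * √r) ^ 2 := by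
          gcongr
          · exact hμ.le
          · omega
      _ = _ := by
          rw [mul_pow, Real.sq_sqrt (by positivity)]
          ring

/-- The number of solver iterations in the `k`-th pass is `O (r c_k ^ 3)`. -/
theorem UsesAPGM.iterations_le (hu : UsesAPGM P U μ τx τy L k₁ θ y s N)
    (h : IsRun P U μ η₁ k₁ θ y η) (hη₁ : 0 ≤ η₁)
    (hμ : 1 < μ) (hν : 0 < ν) (hτx : τx ∈ Set.Ioo (0 : ℝ) 1) (hk₀ : 2 ≤ k₀) (hk₀₁ : k₀ ≤ k₁)
    (hr : 1 ≤ r) (hLf : 1 / μ ^ (k₀ - 1) ≤ (Lf : ℝ))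
    (hf : LipschitzOnWith Lf (obj P U) (box r))
    (hA : LipschitzOnWith LA (constr P U) (box r))
    (hL : ∀ c : ℝ, 0 < c → ∀ w : Dual m, LipschitzWith (L c w) (gradLag P U c w))
    (hreg : ∀ k ∈ Set.Icc k₀ k₁, ν * ‖constr P U (θ k)‖ ≤ ‖-jacTConstr P U (θ k)‖)
    (hbox : ∀ k ∈ Set.Icc 1 k₁, θ k ∈ box r) (hY : yMax P U η₁ θ y ≤ Y)
    (hΓ : ∀ c : ℝ, 0 < c → ∀ w : Dual m, (L c w : ℝ) ≤ Γ * (1 + ‖w‖ + c))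
    {k : ℕ} (h1 : 1 ≤ k) (hk : k < k₁) :
    (N k : ℝ) ≤ iterConst μ ν Y Γ τx Lf LA k₀ * r * (μ ^ 3) ^ k := by
  obtain ⟨hs, hleast, hθ⟩ := hu k h1 hk
  set c := μ ^ k with hc
  have hc1 : 1 ≤ c := one_le_pow₀ hμ.le
  have hc0 : 0 < c := by linarith
  have hK := iterConst_nonneg (ν := ν) (Y := Y) (Γ := Γ) (Lf := Lf) (LA := LA) (k₀ := k₀) hμ hτx
  by_cases h0 : L c (y k) = 0
  · have hN : N k ≤ 0 := hleast.2 (by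
      rw [Set.mem_ofPred_eq, gradLag_eq_zero_of_lipschitz_zero (hL c hc0 (y k)) h0, norm_zero]
      positivity)
    rw [Nat.le_zero.1 hN, Nat.cast_zero]
    positivity
  -- Minimality of `N k`: every earlier iterate violates the tolerance.
  have hlt : ∀ j < N k, 1 / c ≤ ‖gradLag P U c (y k) (solverIter P U τx τy L c (y k) (s k) j)‖ :=
    fun j hj => le_of_not_ge fun hle => absurd (hleast.2 hle) (not_le.2 hj)
  have hd := solverIter_descent (hL c hc0 (y k)) h0 hτx τy (s k) (by positivity) (N k) hlt
  rw [← hθ] at hd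
  -- Only the starting and returned points need to lie in the box; the intermediate iterates may
  -- leave it.
  have hgap := augLag_sub_le hf hA (hbox (k + 1) ⟨by omega, hk⟩) hs hc0.le (y k)
  have hfeas := h.pow_mul_norm_constr_sq_le hη₁ hμ hν hk₀ hk₀₁ hr hLf hf hA hreg hbox hY h1 hk
  have hYa := hY.trans (le_abs_self Y)
  have hy : ‖y k‖ ≤ 2 * |Y| := (h.norm_dual_le hη₁ h1 hk.le).trans (by linarith)
  have hr' : (1 : ℝ) ≤ r := by exact_mod_cast hr
  have hsqr : √(r : ℝ) ≤ r := Real.sqrt_le_iff.2 ⟨by linarith, by nlinarith⟩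
  set E := μ ^ k₀ * (2 * (Lf + |Y| * LA) / ν + LA * (2 * Real.pi)) ^ 2 with hE
  set D := (Lf + 2 * |Y| * LA) * (2 * Real.pi) + E with hD
  have hE0 : 0 ≤ E := by positivity
  have hD0 : 0 ≤ D := by positivity
  have hgap' : augLag P U c (y k) (θ (k + 1)) - augLag P U c (y k) (s k) ≤ D * r := by
    refine hgap.trans ?_
    have h5 : ((Lf : ℝ) + ‖y k‖ * LA) * (2 * Real.pi * √r) ≤
        (Lf + 2 * |Y| * LA) * (2 * Real.pi * r) := by gcongr
    have h6 : 0 ≤ c * ‖constr P U (θ (k + 1))‖ ^ 2 := by positivity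
    rw [hD, add_mul]
    linarith
  have hLc : (L c (y k) : ℝ) ≤ |Γ| * (2 + 2 * |Y|) * c := by
    calc (L c (y k) : ℝ) ≤ Γ * (1 + ‖y k‖ + c) := hΓ c hc0 (y k)
      _ ≤ |Γ| * (1 + ‖y k‖ + c) := by
          gcongr
          exact le_abs_self Γ
      _ ≤ |Γ| * ((2 + 2 * |Y|) * c) := by
          gcongr
          nlinarith [abs_nonneg Y]
      _ = _ := by ring
  have hτ : 0 < τx * (1 - τx) := mul_pos hτx.1 (sub_pos.2 hτx.2)
  have hd' : (N k : ℝ) * (τx * (1 - τx) * (1 / c) ^ 2) ≤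
      |Γ| * (2 + 2 * |Y|) * c * (D * r) := by
    refine hd.trans ((mul_le_mul_of_nonneg_left hgap' (L c (y k)).2).trans ?_)
    exact mul_le_mul_of_nonneg_right hLc (by positivity)
  have hpow : (μ ^ 3) ^ k = c ^ 3 := by rw [hc, ← pow_mul, ← pow_mul, mul_comm]
  rw [hpow, iterConst, ← hE, ← hD]
  have he : |Γ| * (2 + 2 * |Y|) * D / (τx * (1 - τx)) * r * c ^ 3 =
      |Γ| * (2 + 2 * |Y|) * c * (D * r) / (τx * (1 - τx) * (1 / c) ^ 2) := by field_simp
  rw [he, le_div_iff₀ (by positivity)]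
  exact hd'

end Complexity

end VQA

end

/-! ### Assembly of the theorem -/

open scoped NNReal in
theorem theorem1
    (μ η₁ ν Y Γ τx τy : ℝ) (Lf LA : ℝ≥0) (k₀ : ℕ)
    (hμ : 1 < μ) (hη₁ : 0 < η₁) (hν : 0 < ν)
    (hτx : τx ∈ Set.Ioo (0 : ℝ) 1) (hτy : τy ∈ Set.Ioo (0 : ℝ) 1)
    (hk₀ : 2 ≤ k₀) (hk₀Lf : 1 / μ ^ (k₀ - 1) ≤ (Lf : ℝ)) :
    ∃ K : ℝ, 0 < K ∧
      ∀ (n m r : ℕ) (P : VQA.SDP n m) (U : VQA.Ansatz n r)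
        (L : ℝ → VQA.Dual m → ℝ≥0) (k₁ : ℕ)
        (θ : ℕ → VQA.Param r) (y : ℕ → VQA.Dual m) (η : ℕ → ℝ),
        k₀ ≤ k₁ →
        VQA.IsRun P U μ η₁ k₁ θ y η →
        (∀ k ∈ Set.Icc k₀ k₁, θ k ∈ VQA.box r) →
        LipschitzOnWith Lf (VQA.obj P U) (VQA.box r) →
        LipschitzOnWith LA (VQA.constr P U) (VQA.box r) →
        (∀ c : ℝ, 0 < c → ∀ w : VQA.Dual m, LipschitzWith (L c w) (VQA.gradLag P U c w)) →
        (∀ k ∈ Set.Icc k₀ k₁,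
          ν * ‖VQA.constr P U (θ k)‖ ≤ ‖-VQA.jacTConstr P U (θ k)‖) →
        -- convergence rate, for any inexact solver
        (∀ k ∈ Set.Icc k₀ k₁,
          VQA.IsStationary P U
            (1 / μ ^ (k - 1) * VQA.constQ Lf LA (VQA.yMax P U η₁ θ y) ν (η k)) (μ ^ k) (θ k) ∧
          VQA.constQ Lf LA (VQA.yMax P U η₁ θ y) ν (η k) ≤
            VQA.constQ Lf LA (VQA.yMax P U η₁ θ y) ν η₁) ∧
        -- every call of the accelerated proximal gradient method terminates
        (∀ c : ℝ, 0 < c → ∀ (w : VQA.Dual m) (x₀ : VQA.Param r) (δ : ℝ), 0 < δ →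
          ∃ j, ‖VQA.gradLag P U c w (VQA.solverIter P U τx τy L c w x₀ j)‖ ≤ δ) ∧
        -- total complexity with that method as the solver
        (1 ≤ r →
          (∀ k ∈ Set.Icc 1 k₁, θ k ∈ VQA.box r) →
          VQA.yMax P U η₁ θ y ≤ Y →
          (∀ c : ℝ, 0 < c → ∀ w : VQA.Dual m, (L c w : ℝ) ≤ Γ * (1 + ‖w‖ + c)) →
          ∀ (s : ℕ → VQA.Param r) (N : ℕ → ℕ), VQA.UsesAPGM P U μ τx τy L k₁ θ y s N →
          ∀ Q : ℝ, Q = VQA.constQ Lf LA (VQA.yMax P U η₁ θ y) ν η₁ →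
          ∀ ε : ℝ, 0 < ε → ε ≤ 1 / μ →
            (VQA.StopTest P U μ ε θ y k₁ ∨ Q / μ ^ (k₁ - 1) ≤ ε) →
            ∃ k, IsLeast {k | 2 ≤ k ∧ VQA.StopTest P U μ ε θ y k} k ∧ k ≤ k₁ ∧
              VQA.IsStationary P U ε (μ ^ k) (θ k) ∧
              ((∑ j ∈ Finset.Icc 1 (k - 1), (N j + 1) : ℕ) : ℝ) ≤
                K * ((r : ℝ) * Q ^ 3 / ε ^ 3 * Real.logb μ (Q / ε))) := by
  have hμ0 : 0 < μ := by linarith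
  have hq : 1 < μ ^ 3 := one_lt_pow₀ hμ (by norm_num)
  have hq' : 0 < μ ^ 3 - 1 := sub_pos.2 hq
  have hK₁ := VQA.iterConst_nonneg (ν := ν) (Y := Y) (Γ := Γ) (Lf := Lf) (LA := LA) (k₀ := k₀)
    hμ hτx
  set K₁ := VQA.iterConst μ ν Y Γ τx Lf LA k₀ with hK₁def
  -- The `+ 1` pays for the loop pass itself, the middle factor is the geometric sum, and `μ ^ k₀`
  -- bounds the overshoot of the final penalty parameter beyond `Q / ε`.
  refine ⟨(K₁ + 1) * (μ ^ 3 / (μ ^ 3 - 1)) * (μ ^ k₀) ^ 3, by positivity, ?_⟩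
  intro n m r P U L k₁ θ y η hk₀₁ hrun hbox₀ hf hA hL hreg
  have hY0 := VQA.yMax_nonneg P U hη₁.le θ y
  have hres : ∀ k ∈ Set.Icc k₀ k₁,
      ‖VQA.gradLag P U (μ ^ (k - 1)) (y k) (θ k)‖ + ‖VQA.constr P U (θ k)‖ ≤
        1 / μ ^ (k - 1) * VQA.constQ Lf LA (VQA.yMax P U η₁ θ y) ν (η k) := fun k hk =>
    hrun.residual_le hη₁.le hμ hν hf hA (hk₀.trans hk.1) hk.2
      (VQA.one_div_pow_le_of_le hμ hk₀Lf hk.1) (hbox₀ k hk) (hreg k hk)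
  have hη : ∀ k ∈ Set.Icc k₀ k₁, VQA.constQ Lf LA (VQA.yMax P U η₁ θ y) ν (η k) ≤
      VQA.constQ Lf LA (VQA.yMax P U η₁ θ y) ν η₁ := fun k hk =>
    VQA.constQ_mono Lf LA hY0 hν (hrun.eta_mem hη₁.le (by linarith [hk.1]) hk.2).2
  -- The residual bound is the stopping test with precision `ε_k`.
  refine ⟨fun k hk => ⟨VQA.StopTest.isStationary (hres k hk) (hbox₀ k hk) _, hη k hk⟩,
    fun c hc w x₀ δ hδ => VQA.exists_solverIter_le (hL c hc w) hτx τy x₀ hδ, ?_⟩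
  intro hr hbox hY hΓ s N hu Q hQ ε hε hεμ hlong
  have htest : ∀ k ∈ Set.Icc k₀ k₁, Q / μ ^ (k - 1) ≤ ε → VQA.StopTest P U μ ε θ y k := by
    intro k hk hle
    refine (hres k hk).trans (le_trans ?_ hle)
    rw [one_div_mul_eq_div]
    have := hη k hk
    rw [← hQ] at this
    gcongr
  have hlast : VQA.StopTest P U μ ε θ y k₁ := hlong.elim id (htest k₁ ⟨hk₀₁, le_rfl⟩)
  classical
  have hex : ∃ k, 2 ≤ k ∧ VQA.StopTest P U μ ε θ y k := ⟨k₁, hk₀.trans hk₀₁, hlast⟩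
  obtain ⟨k, hk⟩ : ∃ k, IsLeast {k | 2 ≤ k ∧ VQA.StopTest P U μ ε θ y k} k :=
    ⟨Nat.find hex, Nat.find_spec hex, fun j hj => Nat.find_min' hex hj⟩
  have hkk₁ : k ≤ k₁ := hk.2 ⟨hk₀.trans hk₀₁, hlast⟩
  have hk2 : 2 ≤ k := hk.1.1
  refine ⟨k, hk, hkk₁, VQA.StopTest.isStationary hk.1.2 (hbox k ⟨by omega, hkk₁⟩) _, ?_⟩
  have hQ1 : 1 ≤ Q := hQ ▸ VQA.one_le_constQ Lf LA hY0 hν hη₁.le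
  have hr' : (1 : ℝ) ≤ r := by exact_mod_cast hr
  have hQε : μ ≤ Q / ε := by
    rw [le_div_iff₀ hε]
    rw [le_div_iff₀ hμ0] at hεμ
    linarith
  -- Either stopping occurs by `k₀`, or the test failed at `k - 1 ≥ k₀`, which forces `μ ^ (k - 2) <
  -- Q / ε`; the last pass adds one factor `μ`.
  have hpow : μ ^ (k - 1) ≤ μ ^ k₀ * (Q / ε) := by
    by_cases hkk₀ : k ≤ k₀
    · calc μ ^ (k - 1) ≤ μ ^ k₀ := pow_le_pow_right₀ hμ.le (by omega)
        _ ≤ _ := le_mul_of_one_le_right (by positivity) (by linarith)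
    · have hnot : ε < Q / μ ^ (k - 1 - 1) := by
        by_contra! hle
        have := hk.2 ⟨by omega, htest (k - 1) ⟨by omega, by omega⟩ hle⟩
        omega
      have hlt : μ ^ (k - 1 - 1) ≤ Q / ε := by
        rw [lt_div_iff₀ (by positivity)] at hnot
        rw [le_div_iff₀ hε]
        linarith
      calc μ ^ (k - 1) = μ * μ ^ (k - 1 - 1) := by
            rw [← pow_succ']
            congr 1
            omega
        _ ≤ μ ^ k₀ * (Q / ε) := by
            gcongr
            exact le_self_pow₀ hμ.le (by omega)
  -- This is where `ε ≤ 1 / μ` enters, together with `Q ≥ 1`.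
  have hlog : 1 ≤ Real.logb μ (Q / ε) := by
    rw [Real.le_logb_iff_rpow_le hμ (by positivity), Real.rpow_one]
    exact hQε
  have hN : ∀ j ∈ Finset.Icc 1 (k - 1), ((N j + 1 : ℕ) : ℝ) ≤ (K₁ + 1) * r * (μ ^ 3) ^ j := by
    intro j hj
    rw [Finset.mem_Icc] at hj
    have h1 := hu.iterations_le hrun hη₁.le hμ hν hτx hk₀ hk₀₁ hr hk₀Lf hf hA hL hreg hbox hY hΓ
      hj.1 (by omega : j < k₁)
    have h2 : 1 ≤ (r : ℝ) * (μ ^ 3) ^ j := one_le_mul_of_one_le_of_one_le hr' (one_le_pow₀ hq.le)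
    rw [← hK₁def] at h1
    push_cast
    linarith
  rw [Nat.cast_sum]
  calc ∑ j ∈ Finset.Icc 1 (k - 1), ((N j + 1 : ℕ) : ℝ)
      ≤ ∑ j ∈ Finset.Icc 1 (k - 1), (K₁ + 1) * r * (μ ^ 3) ^ j := Finset.sum_le_sum hN
    _ = (K₁ + 1) * r * ∑ j ∈ Finset.Icc 1 (k - 1), (μ ^ 3) ^ j := by rw [Finset.mul_sum]
    _ ≤ (K₁ + 1) * r * (μ ^ 3 / (μ ^ 3 - 1) * (μ ^ (k - 1)) ^ 3) := by
        rw [← pow_mul μ (k - 1) 3, mul_comm (k - 1) 3, pow_mul]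
        gcongr
        exact VQA.sum_pow_Icc_le hq (k - 1)
    _ ≤ (K₁ + 1) * r * (μ ^ 3 / (μ ^ 3 - 1) * (μ ^ k₀ * (Q / ε)) ^ 3) := by gcongr
    _ = (K₁ + 1) * (μ ^ 3 / (μ ^ 3 - 1)) * (μ ^ k₀) ^ 3 * (r * Q ^ 3 / ε ^ 3 * 1) := by
        rw [mul_pow, div_pow]
        ring
    _ ≤ _ := by gcongr
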